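/- For $n\in\mathbb Z$ put $\{n\}=\frac{q^{2n}-1}{q^2-1}\in\mathbb Q(q)$ and, for $x\in\mathbb Q$ with continued fraction $x=a_1+\cfrac{1}{a_2+\cfrac{1}{\ddots+\cfrac1{a_{2m}}}}$ of even length ($a_i\in\mathbb Z$, $a_i\ge 1$ for $i\ge2$), let $$\{x\}=\{a_1\}+\cfrac{q^{2a_1}}{\{a_2\}_{q^{-1}}+\cfrac{q^{-2a_2}}{\{a_3\}+\cfrac{q^{2a_3}}{\ddots+\cfrac{q^{2a_{2m-1}}}{\{a_{2m}\}_{q^{-1}}}}}}$$ be its $q$-deformation, where $\{a\}_{q^{-1}}$ is $\{a\}$ with $q$ replaced by $q^{-1}$. Put $\delta_x=\{x\}-\{x-1\}$ and $\binom{x}{k}_q=\frac{\{x\}\{x-1\}\cdots\{x-k+1\}}{\{k\}\{k-1\}\cdots\{1\}}$. Let $R$ be a nonzero commutative $\mathbb Q(q)$-algebra with an element $\nu$ such that $\nu^2=\delta_x^{-1}$ (for instance $R=\mathbb Q(q)[\nu]/(\nu^2-\delta_x^{-1})$). Let $x\mathbf{Web}$ be the $R$-linear category obtained from the universal (HOMFLY-PT)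 category $\infty\mathbf{Web}$ of oriented $\mathfrak{gl}$-webs with edges labelled by positive integers by setting $a=q\nu\delta_x$, so that a $1$-labelled circle has value $\frac{a-a^{-1}}{q-q^{-1}}$. Then: 1. For every $k\ge 1$, both orientations of the $k$-labelled circle equal $q^{k(k-1)}\nu^k\binom{x}{k}_q\cdot \mathrm{id}_\emptyset$ in $\mathrm{End}_{x\mathbf{Web}}(\emptyset)$. 2. For every $k\ge 0$, $\binom{x}{k}_q\ne0$ unless $x\in\mathbb N$ and $x<k$. 3. Let $n\in\mathbb N$, and let $M$ be the $R$-module of endomorphisms of $\emptyset$ in the quotient of $x\mathbf{Web}$ by the two-sided tensor ideal generated by the identities of the $k$-labelled edges with $k>n$. Unless $x\in\mathbb N$ and $x\le n$, the class of $\mathrm{id}_\emptyset$ in $M$ is a torsion element: some non-zero-divisor $r\in R$ satisfies $r\cdot[\mathrm{id}_\emptyset]=0$ in $M$. -/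

import Mathlib

open CategoryTheory MonoidalCategory

universe u

namespace QWeb

noncomputable section

/-! ### Quantum integers and `q`-rationals -/

/-- The field `ℚ(q)`. -/
abbrev Qq : Type := RatFunc ℚ

/-- The variable `q`. -/
def q : Qq := RatFunc.X

/-- The quantum integer `{n} = (q^{2n} - 1) / (q^2 - 1)`. -/
def qInt (n : ℤ) : Qq := (q ^ (2 * n) - 1) / (q ^ 2 - 1)

/-- The quantum integer `{n}` with `q` replaced by `q⁻¹`. -/
def qIntInv (n : ℤ) : Qq := (q ^ (-(2 * n)) - 1) / (q ^ (-2 : ℤ) - 1)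

/-- The quantum factorial `{k}! = {k}{k-1}⋯{1}`. -/
def qFactorial (k : ℕ) : Qq := ∏ i ∈ Finset.range k, qInt (i + 1)

/-- The quantum binomial coefficient `{n}{n-1}⋯{n-k+1} / {k}!` for an integer `n`. -/
def qBinomInt (n : ℤ) (k : ℕ) : Qq := (∏ i ∈ Finset.range k, qInt (n - i)) / qFactorial k

/-- The entries of the even continued fraction
`x = a₁ + 1/(b₁ + 1/(a₂ + 1/(b₂ + ⋯)))`, grouped in pairs: the first pair `(a₁, b₁)` and the list
`[(a₂, b₂), …]` of the others. All entries except possibly `a₁` are positive. An integer `x` is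
written `(x - 1) + 1/1`, which makes the number of entries even. -/
def evenCF (x : ℚ) : (ℤ × ℤ) × List (ℤ × ℤ) :=
  if Int.fract x = 0 then ((⌊x⌋ - 1, 1), [])
  else if _hy : Int.fract (Int.fract x)⁻¹ = 0 then ((⌊x⌋, ⌊(Int.fract x)⁻¹⌋), [])
  else
    let r := evenCF (Int.fract (Int.fract x)⁻¹)⁻¹
    ((⌊x⌋, ⌊(Int.fract x)⁻¹⌋), r.1 :: r.2)
termination_by x.den
decreasing_by
  have key : ∀ z : ℚ, Int.fract z ≠ 0 → ((Int.fract z)⁻¹).den < z.den := by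
    intro z hz
    have h0 : 0 < Int.fract z := lt_of_le_of_ne (Int.fract_nonneg z) (Ne.symm hz)
    have h1 : Int.fract z < 1 := Int.fract_lt_one z
    have hden : (Int.fract z).den = z.den := by
      have : Int.fract z = z - (⌊z⌋ : ℚ) := rfl
      rw [this, Rat.sub_intCast_den]
    have hnum : 0 < (Int.fract z).num := Rat.num_pos.mpr h0
    have hlt : (Int.fract z).num < (Int.fract z).den := Rat.num_lt_denom_iff.mpr h1
    have hinv : ((Int.fract z)⁻¹).den = (Int.fract z).num.natAbs := by
      rw [Rat.den_inv_of_ne_zero h0.ne']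
    omega
  exact lt_trans (key _ _hy) (key _ ‹_›)

/-- The deformation
`{a₁} + q^{2a₁} / ({b₁}_{q⁻¹} + q^{-2b₁} / ({a₂} + q^{2a₂} / ({b₂}_{q⁻¹} + ⋯)))`
of the continued fraction with entries `a₁, b₁, a₂, b₂, …`. -/
def qCF : ℤ × ℤ → List (ℤ × ℤ) → Qq
  | (a, b), [] => qInt a + q ^ (2 * a) / qIntInv b
  | (a, b), p :: l => qInt a + q ^ (2 * a) / (qIntInv b + q ^ (-(2 * b)) / qCF p l)

/-- The `q`-rational `{x}`. -/
def qRat (x : ℚ) : Qq := qCF (evenCF x).1 (evenCF x).2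

/-- `{x choose k} = {x}{x-1}⋯{x-k+1} / {k}!`. -/
def qBinom (x : ℚ) (k : ℕ) : Qq := (∏ i ∈ Finset.range k, qRat (x - i)) / qFactorial k

/-- `δ_x = {x} - {x-1}`. -/
def qDelta (x : ℚ) : Qq := qRat x - qRat (x - 1)

/-! ### Objects and generating morphisms of the web category -/

/-- Words in upward and downward arrows labelled by positive integers (parenthesized tensor
products of them; the empty word is `unit`). -/
inductive WebObj : Type
  | unit : WebObj
  | up : ℕ+ → WebObj
  | down : ℕ+ → WebObj
  | tensor : WebObj → WebObj → WebObj

local infixr:70 " ⊙ " => WebObj.tensor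

/-- Formal `R`-linear expressions in the generating webs. A term of `WebTerm R X Y` stands for a
combination of webs with bottom boundary `X` and top boundary `Y`. -/
inductive WebTerm (R : Type u) : WebObj → WebObj → Type u
  | idn (X : WebObj) : WebTerm R X X
  | comp {X Y Z : WebObj} (f : WebTerm R X Y) (g : WebTerm R Y Z) : WebTerm R X Z
  | tens {X Y X' Y' : WebObj} (f : WebTerm R X Y) (g : WebTerm R X' Y') :
      WebTerm R (X ⊙ X') (Y ⊙ Y')
  | assoc (X Y Z : WebObj) : WebTerm R ((X ⊙ Y) ⊙ Z) (X ⊙ (Y ⊙ Z))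
  | assocInv (X Y Z : WebObj) : WebTerm R (X ⊙ (Y ⊙ Z)) ((X ⊙ Y) ⊙ Z)
  | lunit (X : WebObj) : WebTerm R (WebObj.unit ⊙ X) X
  | lunitInv (X : WebObj) : WebTerm R X (WebObj.unit ⊙ X)
  | runit (X : WebObj) : WebTerm R (X ⊙ WebObj.unit) X
  | runitInv (X : WebObj) : WebTerm R X (X ⊙ WebObj.unit)
  | zero (X Y : WebObj) : WebTerm R X Y
  | add {X Y : WebObj} (f g : WebTerm R X Y) : WebTerm R X Y
  | smul {X Y : WebObj} (r : R) (f : WebTerm R X Y) : WebTerm R X Y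
  /-- the trivalent vertex merging `k` and `l` into `m = k + l` -/
  | merge (k l m : ℕ+) (h : k + l = m) : WebTerm R (WebObj.up k ⊙ WebObj.up l) (WebObj.up m)
  /-- the trivalent vertex splitting `m = k + l` into `k` and `l` -/
  | split (k l m : ℕ+) (h : k + l = m) : WebTerm R (WebObj.up m) (WebObj.up k ⊙ WebObj.up l)
  | cupUD (k : ℕ+) : WebTerm R WebObj.unit (WebObj.up k ⊙ WebObj.down k)
  | cupDU (k : ℕ+) : WebTerm R WebObj.unit (WebObj.down k ⊙ WebObj.up k)
  | capUD (k : ℕ+) : WebTerm R (WebObj.up k ⊙ WebObj.down k) WebObj.unit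
  | capDU (k : ℕ+) : WebTerm R (WebObj.down k ⊙ WebObj.up k) WebObj.unit

/- Composition is read from bottom to top: `f ⋗ g` is `f` with `g` stacked above it. -/
local infixr:60 " ⋗ " => WebTerm.comp
local infixr:70 " ⊠ " => WebTerm.tens
local infixr:75 " ∙ₛ " => WebTerm.smul
local infixl:55 " ∔ " => WebTerm.add

namespace WebTerm

variable {R : Type u}

/-! #### Duality -/

/-- The dual object: reverse the word and the orientations. -/
def dual : WebObj → WebObj
  | .unit => .unit
  | .up k => .down k
  | .down k => .up k
  | .tensor X Y => dual Y ⊙ dual X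

/-- Nested cups with `X` on the left. -/
def coev : (X : WebObj) → WebTerm R .unit (X ⊙ dual X)
  | .unit => lunitInv .unit
  | .up k => cupUD k
  | .down k => cupDU k
  | .tensor X Y => coev X ⋗ (idn X ⊠ (lunitInv (dual X) ⋗ (coev Y ⊠ idn (dual X)) ⋗
      assoc Y (dual Y) (dual X))) ⋗ assocInv X Y (dual Y ⊙ dual X)

/-- Nested caps with `X` on the right. -/
def ev : (X : WebObj) → WebTerm R (dual X ⊙ X) .unit
  | .unit => lunit .unit
  | .up k => capDU k
  | .down k => capUD k
  | .tensor X Y => assoc (dual Y) (dual X) (X ⊙ Y) ⋗ (idn (dual Y) ⊠ (assocInv (dual X) X Y ⋗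
      (ev X ⊠ idn Y) ⋗ lunit Y)) ⋗ ev Y

/-- Nested cups with `X` on the right. -/
def coev' : (X : WebObj) → WebTerm R .unit (dual X ⊙ X)
  | .unit => lunitInv .unit
  | .up k => cupDU k
  | .down k => cupUD k
  | .tensor X Y => coev' Y ⋗ (idn (dual Y) ⊠ (lunitInv Y ⋗ (coev' X ⊠ idn Y) ⋗
      assoc (dual X) X Y)) ⋗ assocInv (dual Y) (dual X) (X ⊙ Y)

/-- Nested caps with `X` on the left. -/
def ev' : (X : WebObj) → WebTerm R (X ⊙ dual X) .unit
  | .unit => lunit .unit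
  | .up k => capUD k
  | .down k => capDU k
  | .tensor X Y => assoc X Y (dual Y ⊙ dual X) ⋗ (idn X ⊠ (assocInv Y (dual Y) (dual X) ⋗
      (ev' Y ⊠ idn (dual X)) ⋗ lunit (dual X))) ⋗ ev' X

/-- The half rotation of `f` in one direction. -/
def rightMate {X Y : WebObj} (f : WebTerm R X Y) : WebTerm R (dual Y) (dual X) :=
  runitInv (dual Y) ⋗ (idn (dual Y) ⊠ coev X) ⋗ (idn (dual Y) ⊠ (f ⊠ idn (dual X))) ⋗
    assocInv (dual Y) Y (dual X) ⋗ (ev Y ⊠ idn (dual X)) ⋗ lunit (dual X)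

/-- The half rotation of `f` in the other direction. -/
def leftMate {X Y : WebObj} (f : WebTerm R X Y) : WebTerm R (dual Y) (dual X) :=
  lunitInv (dual Y) ⋗ (coev' X ⊠ idn (dual Y)) ⋗ ((idn (dual X) ⊠ f) ⊠ idn (dual Y)) ⋗
    assoc (dual X) Y (dual Y) ⋗ (idn (dual X) ⊠ ev' Y) ⋗ runit (dual X)

/-! #### Ladders

In the relations between upward webs, edges labelled `0` are erased, and a web with a negative
label is zero. -/

/-- The upward strand labelled `k`, which is empty for `k = 0`. -/
def strand : ℕ → WebObj
  | 0 => .unit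
  | k + 1 => .up k.succPNat

/-- The identity, between strands with equal labels. -/
def strandCast (k m : ℕ) (h : k = m) : WebTerm R (strand k) (strand m) := h ▸ idn (strand k)

/-- The merge vertex `k + l = m`, where edges labelled `0` are erased. -/
def merge₀ : (k l m : ℕ) → k + l = m → WebTerm R (strand k ⊙ strand l) (strand m)
  | 0, l, m, h => lunit (strand l) ⋗ strandCast l m (by omega)
  | k + 1, 0, m, h => runit (strand (k + 1)) ⋗ strandCast (k + 1) m h
  | _ + 1, _ + 1, 0, h => absurd h (by omega)
  | k + 1, l + 1, m + 1, h => merge k.succPNat l.succPNat m.succPNat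
      (PNat.coe_injective (by simpa [PNat.add_coe, Nat.succPNat_coe] using h))

/-- The split vertex `m = k + l`, where edges labelled `0` are erased. -/
def split₀ : (k l m : ℕ) → k + l = m → WebTerm R (strand m) (strand k ⊙ strand l)
  | 0, l, m, h => strandCast m l (by omega) ⋗ lunitInv (strand l)
  | k + 1, 0, m, h => strandCast m (k + 1) h.symm ⋗ runitInv (strand (k + 1))
  | _ + 1, _ + 1, 0, h => absurd h (by omega)
  | k + 1, l + 1, m + 1, h => split k.succPNat l.succPNat m.succPNat
      (PNat.coe_injective (by simpa [PNat.add_coe, Nat.succPNat_coe] using h))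

/-- Two upward strands with labels `k, l` at the bottom and `k', l'` at the top, joined by a rung
labelled `j` going up from the right strand to the left strand. It is zero unless `k' = k + j` and
`l' = l - j ≥ 0`. -/
def rungL (j k l k' l' : ℕ) : WebTerm R (strand k ⊙ strand l) (strand k' ⊙ strand l') :=
  if h : k + j = k' ∧ j + l' = l then
    (idn (strand k) ⊠ split₀ j l' l h.2) ⋗ assocInv (strand k) (strand j) (strand l') ⋗
      (merge₀ k j k' h.1 ⊠ idn (strand l'))
  else zero _ _

/-- Two upward strands with labels `k, l` at the bottom and `k', l'` at the top, joined by a rung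
labelled `j` going up from the left strand to the right strand. It is zero unless
`k' = k - j ≥ 0` and `l' = l + j`. -/
def rungR (j k l k' l' : ℕ) : WebTerm R (strand k ⊙ strand l) (strand k' ⊙ strand l') :=
  if h : k' + j = k ∧ j + l = l' then
    (split₀ k' j k h.1 ⊠ idn (strand l)) ⋗ assoc (strand k') (strand j) (strand l) ⋗
      (idn (strand k') ⊠ merge₀ j l l' h.2)
  else zero _ _

/-- Three upward strands. -/
abbrev strand₃ (k l r : ℕ) : WebObj := (strand k ⊙ strand l) ⊙ strand r

/-- A rung from the second to the first of three strands; the labels of all three strands are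
given at the bottom and, for the strands that change, at the top. -/
def rung21 (j k l r k' l' : ℕ) : WebTerm R (strand₃ k l r) (strand₃ k' l' r) :=
  rungL j k l k' l' ⊠ idn (strand r)

/-- A rung from the first to the second of three strands. -/
def rung12 (j k l r k' l' : ℕ) : WebTerm R (strand₃ k l r) (strand₃ k' l' r) :=
  rungR j k l k' l' ⊠ idn (strand r)

/-- A rung from the third to the second of three strands. -/
def rung32 (j k l r l' r' : ℕ) : WebTerm R (strand₃ k l r) (strand₃ k l' r') :=
  assoc _ _ _ ⋗ (idn (strand k) ⊠ rungL j l r l' r') ⋗ assocInv _ _ _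

/-- A rung from the second to the third of three strands. -/
def rung23 (j k l r l' r' : ℕ) : WebTerm R (strand₃ k l r) (strand₃ k l' r') :=
  assoc _ _ _ ⋗ (idn (strand k) ⊠ rungR j l r l' r') ⋗ assocInv _ _ _

/-! #### Mixed webs with labels `1` and `2` -/

/-- Two strands labelled `1` merging into an edge labelled `2` and splitting again. -/
def dumbbell : WebTerm R (.up 1 ⊙ .up 1) (.up 1 ⊙ .up 1) :=
  merge 1 1 2 rfl ⋗ split 1 1 2 rfl

/-- The web with vertical edges `1, 2, 1` and a sideway edge labelled `1` closing up on the
right. -/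
def sidewayDigonRight : WebTerm R (.up 1) (.up 1) :=
  runitInv _ ⋗ (idn _ ⊠ cupUD 1) ⋗ assocInv _ _ _ ⋗ (dumbbell ⊠ idn _) ⋗ assoc _ _ _ ⋗
    (idn _ ⊠ capUD 1) ⋗ runit _

/-- The web with vertical edges `1, 2, 1` and a sideway edge labelled `1` closing up on the
left. -/
def sidewayDigonLeft : WebTerm R (.up 1) (.up 1) :=
  lunitInv _ ⋗ (cupDU 1 ⊠ idn _) ⋗ assoc _ _ _ ⋗ (idn _ ⊠ dumbbell) ⋗ assocInv _ _ _ ⋗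
    (capDU 1 ⊠ idn _) ⋗ lunit _

/-- The dumbbell with its edge labelled `2` pointing to the right. -/
def dumbbellToRight : WebTerm R (.up 1 ⊙ .down 1) (.down 1 ⊙ .up 1) :=
  lunitInv _ ⋗ (cupDU 1 ⊠ idn _) ⋗ assoc _ _ _ ⋗
    (idn (.down 1) ⊠ (assocInv _ _ _ ⋗ (dumbbell ⊠ idn (.down 1)) ⋗ assoc _ _ _ ⋗
      (idn (.up 1) ⊠ capUD 1) ⋗ runit _))

/-- The dumbbell with its edge labelled `2` pointing to the left. -/
def dumbbellToLeft : WebTerm R (.down 1 ⊙ .up 1) (.up 1 ⊙ .down 1) :=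
  (idn (.down 1) ⊠ (runitInv _ ⋗ (idn (.up 1) ⊠ cupUD 1) ⋗ assocInv _ _ _ ⋗
      (dumbbell ⊠ idn (.down 1)) ⋗ assoc _ _ _)) ⋗
    assocInv _ _ _ ⋗ (capDU 1 ⊠ idn _) ⋗ lunit _

end WebTerm

/-! ### Coefficients and relations -/

section Relations

variable (R : Type u) [CommRing R] [Algebra Qq R]

/-- An element of `ℚ(q)` seen in `R`. -/
abbrev coef (c : Qq) : R := algebraMap Qq R c

variable {R}

/-- `(a q^{-i} - a⁻¹ q^i) / (q - q⁻¹)`, for an invertible element `a` of `R`. -/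
def bracket (a : R) (i : ℕ) : R :=
  coef R (q - q⁻¹)⁻¹ * (a * coef R (q ^ (-(i : ℤ))) - Ring.inverse a * coef R (q ^ i))

/-- The value `μ_k` of the circle labelled `k`:
`∏_{i < k} (a q^{-i} - a⁻¹ q^i) / (q - q⁻¹)` times `q^{k(k-1)/2} / {k}!`. -/
def circleValue (a : R) (k : ℕ) : R :=
  (∏ i ∈ Finset.range k, bracket a i) * coef R (q ^ (k * (k - 1) / 2) / qFactorial k)

open WebTerm

/-- The congruence on formal webs that defines the pivotal `R`-linear monoidal category of webs. -/
inductive WebRel (a : R) : {X Y : WebObj} → WebTerm R X Y → WebTerm R X Y → Prop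
  -- equivalence relation, compatible with all operations
  | refl {X Y} (f : WebTerm R X Y) : WebRel a f f
  | symm {X Y} {f g : WebTerm R X Y} : WebRel a f g → WebRel a g f
  | trans {X Y} {f g h : WebTerm R X Y} : WebRel a f g → WebRel a g h → WebRel a f h
  | comp_congr {X Y Z} {f f' : WebTerm R X Y} {g g' : WebTerm R Y Z} :
      WebRel a f f' → WebRel a g g' → WebRel a (f ⋗ g) (f' ⋗ g')
  | tens_congr {X Y X' Y'} {f f' : WebTerm R X Y} {g g' : WebTerm R X' Y'} :
      WebRel a f f' → WebRel a g g' → WebRel a (f ⊠ g) (f' ⊠ g')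
  | add_congr {X Y} {f f' g g' : WebTerm R X Y} :
      WebRel a f f' → WebRel a g g' → WebRel a (f ∔ g) (f' ∔ g')
  | smul_congr {X Y} (r : R) {f f' : WebTerm R X Y} :
      WebRel a f f' → WebRel a (r ∙ₛ f) (r ∙ₛ f')
  -- `R`-modules
  | add_assoc {X Y} (f g h : WebTerm R X Y) : WebRel a (f ∔ g ∔ h) (f ∔ (g ∔ h))
  | add_comm {X Y} (f g : WebTerm R X Y) : WebRel a (f ∔ g) (g ∔ f)
  | zero_add {X Y} (f : WebTerm R X Y) : WebRel a (zero X Y ∔ f) f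
  | smul_add {X Y} (r : R) (f g : WebTerm R X Y) : WebRel a (r ∙ₛ (f ∔ g)) (r ∙ₛ f ∔ r ∙ₛ g)
  | add_smul {X Y} (r s : R) (f : WebTerm R X Y) : WebRel a ((r + s) ∙ₛ f) (r ∙ₛ f ∔ s ∙ₛ f)
  | mul_smul {X Y} (r s : R) (f : WebTerm R X Y) : WebRel a ((r * s) ∙ₛ f) (r ∙ₛ s ∙ₛ f)
  | one_smul {X Y} (f : WebTerm R X Y) : WebRel a ((1 : R) ∙ₛ f) f
  | zero_smul {X Y} (f : WebTerm R X Y) : WebRel a ((0 : R) ∙ₛ f) (zero X Y)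
  -- category, bilinearity of the composition
  | id_comp {X Y} (f : WebTerm R X Y) : WebRel a (idn X ⋗ f) f
  | comp_id {X Y} (f : WebTerm R X Y) : WebRel a (f ⋗ idn Y) f
  | comp_assoc {W X Y Z} (f : WebTerm R W X) (g : WebTerm R X Y) (h : WebTerm R Y Z) :
      WebRel a ((f ⋗ g) ⋗ h) (f ⋗ (g ⋗ h))
  | add_comp {X Y Z} (f g : WebTerm R X Y) (h : WebTerm R Y Z) :
      WebRel a ((f ∔ g) ⋗ h) ((f ⋗ h) ∔ (g ⋗ h))
  | comp_add {X Y Z} (f : WebTerm R X Y) (g h : WebTerm R Y Z) :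
      WebRel a (f ⋗ (g ∔ h)) ((f ⋗ g) ∔ (f ⋗ h))
  | smul_comp {X Y Z} (r : R) (f : WebTerm R X Y) (g : WebTerm R Y Z) :
      WebRel a ((r ∙ₛ f) ⋗ g) (r ∙ₛ (f ⋗ g))
  | comp_smul {X Y Z} (r : R) (f : WebTerm R X Y) (g : WebTerm R Y Z) :
      WebRel a (f ⋗ (r ∙ₛ g)) (r ∙ₛ (f ⋗ g))
  -- monoidal category, bilinearity of the tensor product
  | id_tens_id (X Y) : WebRel a (idn X ⊠ idn Y) (idn (X ⊙ Y))
  | tens_comp_tens {X₁ Y₁ Z₁ X₂ Y₂ Z₂} (f₁ : WebTerm R X₁ Y₁) (f₂ : WebTerm R X₂ Y₂)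
      (g₁ : WebTerm R Y₁ Z₁) (g₂ : WebTerm R Y₂ Z₂) :
      WebRel a ((f₁ ⊠ f₂) ⋗ (g₁ ⊠ g₂)) ((f₁ ⋗ g₁) ⊠ (f₂ ⋗ g₂))
  | add_tens {X Y X' Y'} (f g : WebTerm R X Y) (h : WebTerm R X' Y') :
      WebRel a ((f ∔ g) ⊠ h) ((f ⊠ h) ∔ (g ⊠ h))
  | tens_add {X Y X' Y'} (f : WebTerm R X Y) (g h : WebTerm R X' Y') :
      WebRel a (f ⊠ (g ∔ h)) ((f ⊠ g) ∔ (f ⊠ h))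
  | smul_tens {X Y X' Y'} (r : R) (f : WebTerm R X Y) (g : WebTerm R X' Y') :
      WebRel a ((r ∙ₛ f) ⊠ g) (r ∙ₛ (f ⊠ g))
  | tens_smul {X Y X' Y'} (r : R) (f : WebTerm R X Y) (g : WebTerm R X' Y') :
      WebRel a (f ⊠ (r ∙ₛ g)) (r ∙ₛ (f ⊠ g))
  | assoc_naturality {X₁ X₂ X₃ Y₁ Y₂ Y₃} (f₁ : WebTerm R X₁ Y₁) (f₂ : WebTerm R X₂ Y₂)
      (f₃ : WebTerm R X₃ Y₃) :
      WebRel a (((f₁ ⊠ f₂) ⊠ f₃) ⋗ assoc Y₁ Y₂ Y₃) (assoc X₁ X₂ X₃ ⋗ (f₁ ⊠ (f₂ ⊠ f₃)))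
  | lunit_naturality {X Y} (f : WebTerm R X Y) :
      WebRel a ((idn .unit ⊠ f) ⋗ lunit Y) (lunit X ⋗ f)
  | runit_naturality {X Y} (f : WebTerm R X Y) :
      WebRel a ((f ⊠ idn .unit) ⋗ runit Y) (runit X ⋗ f)
  | assoc_assocInv (X Y Z) : WebRel a (assoc X Y Z ⋗ assocInv X Y Z) (idn _)
  | assocInv_assoc (X Y Z) : WebRel a (assocInv X Y Z ⋗ assoc X Y Z) (idn _)
  | lunit_lunitInv (X) : WebRel a (lunit X ⋗ lunitInv X) (idn _)
  | lunitInv_lunit (X) : WebRel a (lunitInv X ⋗ lunit X) (idn _)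
  | runit_runitInv (X) : WebRel a (runit X ⋗ runitInv X) (idn _)
  | runitInv_runit (X) : WebRel a (runitInv X ⋗ runit X) (idn _)
  | pentagon (W X Y Z) :
      WebRel a ((assoc W X Y ⊠ idn Z) ⋗ (assoc W (X ⊙ Y) Z ⋗ (idn W ⊠ assoc X Y Z)))
        (assoc (W ⊙ X) Y Z ⋗ assoc W X (Y ⊙ Z))
  | triangle (X Y) : WebRel a (assoc X .unit Y ⋗ (idn X ⊠ lunit Y)) (runit X ⊠ idn Y)
  -- pivotal structure (isotopy): cups and caps straighten, full rotations are trivial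
  | zigzag_up (k : ℕ+) :
      WebRel a (lunitInv (.up k) ⋗ (cupUD k ⊠ idn (.up k)) ⋗ assoc _ _ _ ⋗
        (idn (.up k) ⊠ capDU k) ⋗ runit (.up k)) (idn (.up k))
  | zigzag_down (k : ℕ+) :
      WebRel a (runitInv (.down k) ⋗ (idn (.down k) ⊠ cupUD k) ⋗ assocInv _ _ _ ⋗
        (capDU k ⊠ idn (.down k)) ⋗ lunit (.down k)) (idn (.down k))
  | zigzag_up' (k : ℕ+) :
      WebRel a (runitInv (.up k) ⋗ (idn (.up k) ⊠ cupDU k) ⋗ assocInv _ _ _ ⋗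
        (capUD k ⊠ idn (.up k)) ⋗ lunit (.up k)) (idn (.up k))
  | zigzag_down' (k : ℕ+) :
      WebRel a (lunitInv (.down k) ⋗ (cupDU k ⊠ idn (.down k)) ⋗ assoc _ _ _ ⋗
        (idn (.down k) ⊠ capUD k) ⋗ runit (.down k)) (idn (.down k))
  | pivotal {X Y} (f : WebTerm R X Y) : WebRel a (leftMate f) (rightMate f)
  -- upward webs
  | merge_assoc (k l r kl lr s : ℕ+) (h₁ : k + l = kl) (h₂ : kl + r = s) (h₃ : l + r = lr)
      (h₄ : k + lr = s) :
      WebRel a ((merge k l kl h₁ ⊠ idn (.up r)) ⋗ merge kl r s h₂)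
        (assoc _ _ _ ⋗ (idn (.up k) ⊠ merge l r lr h₃) ⋗ merge k lr s h₄)
  | split_assoc (k l r kl lr s : ℕ+) (h₁ : k + l = kl) (h₂ : kl + r = s) (h₃ : l + r = lr)
      (h₄ : k + lr = s) :
      WebRel a (split kl r s h₂ ⋗ (split k l kl h₁ ⊠ idn (.up r)))
        (split k lr s h₄ ⋗ (idn (.up k) ⊠ split l r lr h₃) ⋗ assocInv _ _ _)
  | digon (k l m : ℕ+) (h : k + l = m) :
      WebRel a (split k l m h ⋗ merge k l m h)
        (coef R (q ^ (-((k : ℤ) * l)) * qBinomInt m k) ∙ₛ idn (.up m))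
  | square (k l : ℕ) :
      WebRel a
        ((rungR 1 k l (k - 1) (l + 1) ⋗ rungL 1 (k - 1) (l + 1) k l) ∔
          (-1 : R) ∙ₛ (rungL 1 k l (k + 1) (l - 1) ⋗ rungR 1 (k + 1) (l - 1) k l))
        (coef R (q ^ (1 - (k : ℤ) + l) * qInt (k - l)) ∙ₛ idn (strand k ⊙ strand l))
  | serre₁ (k l r : ℕ) :
      WebRel a
        ((rung32 1 k l r (l + 1) (r - 1) ⋗ rung21 2 k (l + 1) (r - 1) (k + 2) (l - 1)) ∔
          (-1 : R) ∙ₛ (rung21 1 k l r (k + 1) (l - 1) ⋗ rung32 1 (k + 1) (l - 1) r l (r - 1) ⋗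
            rung21 1 (k + 1) l (r - 1) (k + 2) (l - 1)) ∔
          (rung21 2 k l r (k + 2) (l - 2) ⋗ rung32 1 (k + 2) (l - 2) r (l - 1) (r - 1)))
        (zero _ _)
  | serre₂ (k l r : ℕ) :
      WebRel a
        ((rung21 1 k l r (k + 1) (l - 1) ⋗ rung32 2 (k + 1) (l - 1) r (l + 1) (r - 2)) ∔
          (-1 : R) ∙ₛ (rung32 1 k l r (l + 1) (r - 1) ⋗ rung21 1 k (l + 1) (r - 1) (k + 1) l ⋗
            rung32 1 (k + 1) l (r - 1) (l + 1) (r - 2)) ∔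
          (rung32 2 k l r (l + 2) (r - 2) ⋗ rung21 1 k (l + 2) (r - 2) (k + 1) (l + 1)))
        (zero _ _)
  | serre₃ (k l r : ℕ) :
      WebRel a
        ((rung23 1 k l r (l - 1) (r + 1) ⋗ rung12 2 k (l - 1) (r + 1) (k - 2) (l + 1)) ∔
          (-1 : R) ∙ₛ (rung12 1 k l r (k - 1) (l + 1) ⋗ rung23 1 (k - 1) (l + 1) r l (r + 1) ⋗
            rung12 1 (k - 1) l (r + 1) (k - 2) (l + 1)) ∔
          (rung12 2 k l r (k - 2) (l + 2) ⋗ rung23 1 (k - 2) (l + 2) r (l + 1) (r + 1)))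
        (zero _ _)
  | serre₄ (k l r : ℕ) :
      WebRel a
        ((rung12 1 k l r (k - 1) (l + 1) ⋗ rung23 2 (k - 1) (l + 1) r (l - 1) (r + 2)) ∔
          (-1 : R) ∙ₛ (rung23 1 k l r (l - 1) (r + 1) ⋗ rung12 1 k (l - 1) (r + 1) (k - 1) l ⋗
            rung23 1 (k - 1) l (r + 1) (l - 1) (r + 2)) ∔
          (rung23 2 k l r (l - 2) (r + 2) ⋗ rung12 1 k (l - 2) (r + 2) (k - 1) (l - 1)))
        (zero _ _)
  -- mixed webs
  | circle (k : ℕ+) : WebRel a (cupUD k ⋗ capUD k) (circleValue a k ∙ₛ idn .unit)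
  | circle' (k : ℕ+) : WebRel a (cupDU k ⋗ capDU k) (circleValue a k ∙ₛ idn .unit)
  | sideway_digon_right : WebRel a sidewayDigonRight (bracket a 1 ∙ₛ idn (.up 1))
  | sideway_digon_left : WebRel a sidewayDigonLeft (bracket a 1 ∙ₛ idn (.up 1))
  | mixed_square :
      WebRel a (dumbbellToRight ⋗ dumbbellToLeft)
        (idn (.up 1 ⊙ .down 1) ∔ bracket a 2 ∙ₛ (capUD 1 ⋗ cupUD 1))
  | mixed_square_mirror :
      WebRel a (dumbbellToLeft ⋗ dumbbellToRight)
        (idn (.down 1 ⊙ .up 1) ∔ bracket a 2 ∙ₛ (capDU 1 ⋗ cupDU 1))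

end Relations

/-! ### The web categories -/

section Category

variable (R : Type u) [CommRing R] [Algebra Qq R]

/-- The specialization of the universal web category `∞Web` at an invertible element `a` of a
`ℚ(q)`-algebra `R`: the pivotal `R`-linear monoidal category generated by upward webs, with the
mixed relations. The usual formulas express the crossings of upward strands as combinations of
ladders, and the other crossings are rotations of these. Since all quantum integers `{k}`, `k ≥ 1`,
are invertible in `R`, the axioms of a braiding are consequences of the relations, so that
generating the category as a braided pivotal category gives the same result. -/
def Web (_a : R) : Type := WebObj

namespace Web

variable {R}
variable (a : R)

/-- The congruence of webs, as a setoid. -/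
def webSetoid (X Y : WebObj) : Setoid (WebTerm R X Y) where
  r := WebRel a
  iseqv := ⟨WebRel.refl, WebRel.symm, WebRel.trans⟩

/-- Linear combinations of webs from `X` to `Y`, modulo the relations. -/
def Hom (X Y : WebObj) : Type u := Quotient (webSetoid a X Y)

variable {a}

/-- The morphism represented by a formal combination of webs. -/
def mk {X Y : WebObj} (f : WebTerm R X Y) : Hom a X Y := Quotient.mk (webSetoid a X Y) f

theorem mk_eq {X Y : WebObj} {f g : WebTerm R X Y} (h : WebRel a f g) :
    (mk f : Hom a X Y) = mk g := Quotient.sound h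

/-- Composition of morphisms (stacking). -/
def comp {X Y Z : WebObj} (f : Hom a X Y) (g : Hom a Y Z) : Hom a X Z :=
  Quotient.map₂ WebTerm.comp (fun _ _ h _ _ h' => WebRel.comp_congr h h') f g

/-- Tensor product of morphisms (juxtaposition). -/
def tens {X Y X' Y' : WebObj} (f : Hom a X Y) (g : Hom a X' Y') :
    Hom a (X.tensor X') (Y.tensor Y') :=
  Quotient.map₂ WebTerm.tens (fun _ _ h _ _ h' => WebRel.tens_congr h h') f g

instance (X Y : WebObj) : Zero (Hom a X Y) := ⟨mk (.zero X Y)⟩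

instance (X Y : WebObj) : Add (Hom a X Y) :=
  ⟨Quotient.map₂ WebTerm.add (fun _ _ h _ _ h' => WebRel.add_congr h h')⟩

instance (X Y : WebObj) : SMul R (Hom a X Y) :=
  ⟨fun r => Quotient.map (WebTerm.smul r) (fun _ _ h => WebRel.smul_congr r h)⟩

instance (X Y : WebObj) : Neg (Hom a X Y) := ⟨fun f => (-1 : R) • f⟩

instance homAddCommGroup (X Y : WebObj) : AddCommGroup (Hom a X Y) where
  add_assoc := by rintro ⟨f⟩ ⟨g⟩ ⟨h⟩; exact mk_eq (.add_assoc f g h)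
  zero_add := by rintro ⟨f⟩; exact mk_eq (.zero_add f)
  add_zero := by rintro ⟨f⟩; exact mk_eq (.trans (.add_comm _ _) (.zero_add f))
  add_comm := by rintro ⟨f⟩ ⟨g⟩; exact mk_eq (.add_comm f g)
  neg_add_cancel := by
    rintro ⟨f⟩
    refine mk_eq (.trans (.add_congr (.refl _) (.symm (.one_smul f))) ?_)
    refine .trans (.symm (.add_smul _ _ f)) ?_
    rw [neg_add_cancel]
    exact .zero_smul f
  nsmul := nsmulRec
  zsmul := zsmulRec

instance homModule (X Y : WebObj) : Module R (Hom a X Y) where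
  one_smul := by rintro ⟨f⟩; exact mk_eq (.one_smul f)
  mul_smul := by rintro r s ⟨f⟩; exact mk_eq (.mul_smul r s f)
  smul_zero r := by
    refine mk_eq (.trans (.smul_congr r (.symm (.zero_smul (.zero _ _)))) ?_)
    refine .trans (.symm (.mul_smul _ _ _)) ?_
    rw [mul_zero]
    exact .zero_smul _
  smul_add := by rintro r ⟨f⟩ ⟨g⟩; exact mk_eq (.smul_add r f g)
  add_smul := by rintro r s ⟨f⟩; exact mk_eq (.add_smul r s f)
  zero_smul := by rintro ⟨f⟩; exact mk_eq (.zero_smul f)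

instance : Category (Web R a) where
  Hom X Y := Hom a X Y
  id X := mk (.idn X)
  comp f g := comp f g
  id_comp := by rintro X Y ⟨f⟩; exact mk_eq (.id_comp f)
  comp_id := by rintro X Y ⟨f⟩; exact mk_eq (.comp_id f)
  assoc := by rintro W X Y Z ⟨f⟩ ⟨g⟩ ⟨h⟩; exact mk_eq (.comp_assoc f g h)

instance : Preadditive (Web R a) where
  homGroup X Y := homAddCommGroup X Y
  add_comp := by rintro X Y Z ⟨f⟩ ⟨g⟩ ⟨h⟩; exact mk_eq (.add_comp f g h)
  comp_add := by rintro X Y Z ⟨f⟩ ⟨g⟩ ⟨h⟩; exact mk_eq (.comp_add f g h)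

instance : Linear R (Web R a) where
  homModule X Y := homModule X Y
  smul_comp := by rintro X Y Z r ⟨f⟩ ⟨g⟩; exact mk_eq (.smul_comp r f g)
  comp_smul := by rintro X Y Z ⟨f⟩ r ⟨g⟩; exact mk_eq (.comp_smul r f g)

instance : MonoidalCategoryStruct (Web R a) where
  tensorObj X Y := WebObj.tensor X Y
  tensorUnit := WebObj.unit
  tensorHom f g := tens f g
  whiskerLeft X _ _ f := tens (mk (.idn X)) f
  whiskerRight f Y := tens f (mk (.idn Y))
  associator X Y Z :=
    { hom := mk (.assoc X Y Z)
      inv := mk (.assocInv X Y Z)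
      hom_inv_id := mk_eq (.assoc_assocInv X Y Z)
      inv_hom_id := mk_eq (.assocInv_assoc X Y Z) }
  leftUnitor X :=
    { hom := mk (.lunit X)
      inv := mk (.lunitInv X)
      hom_inv_id := mk_eq (.lunit_lunitInv X)
      inv_hom_id := mk_eq (.lunitInv_lunit X) }
  rightUnitor X :=
    { hom := mk (.runit X)
      inv := mk (.runitInv X)
      hom_inv_id := mk_eq (.runit_runitInv X)
      inv_hom_id := mk_eq (.runitInv_runit X) }

instance : MonoidalCategory (Web R a) :=
  MonoidalCategory.ofTensorHom
    (id_tensorHom_id := fun X Y => mk_eq (.id_tens_id X Y))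
    (id_tensorHom := fun _ _ _ _ => rfl)
    (tensorHom_id := fun _ _ => rfl)
    (tensorHom_comp_tensorHom := by
      rintro _ _ _ _ _ _ ⟨f₁⟩ ⟨f₂⟩ ⟨g₁⟩ ⟨g₂⟩; exact mk_eq (.tens_comp_tens f₁ f₂ g₁ g₂))
    (associator_naturality := by
      rintro _ _ _ _ _ _ ⟨f₁⟩ ⟨f₂⟩ ⟨f₃⟩; exact mk_eq (.assoc_naturality f₁ f₂ f₃))
    (leftUnitor_naturality := by rintro _ _ ⟨f⟩; exact mk_eq (.lunit_naturality f))
    (rightUnitor_naturality := by rintro _ _ ⟨f⟩; exact mk_eq (.runit_naturality f))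
    (pentagon := fun W X Y Z => mk_eq (.pentagon W X Y Z))
    (triangle := fun X Y => mk_eq (.triangle X Y))

instance : MonoidalPreadditive (Web R a) where
  whiskerLeft_zero {X Y Z} := by
    have h := mk_eq (a := a) (.trans (.tens_congr (.refl (.idn X)) (.symm (.zero_smul (.zero Y Z))))
      (.trans (.tens_smul (0 : R) (.idn X) (.zero Y Z)) (.zero_smul _)))
    exact h
  zero_whiskerRight {X Y Z} := by
    have h := mk_eq (a := a) (.trans (.tens_congr (.symm (.zero_smul (.zero Y Z))) (.refl (.idn X)))
      (.trans (.smul_tens (0 : R) (.zero Y Z) (.idn X)) (.zero_smul _)))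
    exact h
  whiskerLeft_add := by rintro _ _ _ ⟨f⟩ ⟨g⟩; exact mk_eq (.tens_add _ f g)
  add_whiskerRight := by rintro _ _ _ ⟨f⟩ ⟨g⟩; exact mk_eq (.add_tens f g _)

instance : MonoidalLinear R (Web R a) where
  whiskerLeft_smul := by rintro _ _ _ r ⟨f⟩; exact mk_eq (.tens_smul r _ f)
  smul_whiskerRight := by rintro r _ _ ⟨f⟩ _; exact mk_eq (.smul_tens r f _)

/-- The upward arrow labelled `k`, as an object. -/
def up (k : ℕ+) : Web R a := WebObj.up k

/-- The downward arrow labelled `k`, as an object. -/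
def down (k : ℕ+) : Web R a := WebObj.down k

/-- The circle labelled `k` that goes up on the left and down on the right. -/
def circleUD (k : ℕ+) : 𝟙_ (Web R a) ⟶ 𝟙_ (Web R a) :=
  mk (WebTerm.comp (WebTerm.cupUD k) (WebTerm.capUD k))

/-- The circle labelled `k` that goes down on the left and up on the right. -/
def circleDU (k : ℕ+) : 𝟙_ (Web R a) ⟶ 𝟙_ (Web R a) :=
  mk (WebTerm.comp (WebTerm.cupDU k) (WebTerm.capDU k))

/-- The identities of the upward edges whose label is greater than `n`. -/
inductive LargeEdge (n : ℕ) : ∀ X Y : Web R a, (X ⟶ Y) → Prop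
  | mk (k : ℕ+) (hk : n < k) : LargeEdge n (up k) (up k) (𝟙 (up k))

end Web

/-- The category `xWeb`, over a `ℚ(q)`-algebra `R` that contains a square root `ν` of `δ_x⁻¹`:
the specialization of `∞Web` at `a = q ν δ_x`. -/
abbrev XWeb {R : Type u} [CommRing R] [Algebra Qq R] (x : ℚ) (ν : R) : Type :=
  Web R (coef R q * ν * coef R (qDelta x))

/-- The scalar `q^{k(k-1)} ν^k {x choose k}`. -/
def xCircleValue {R : Type u} [CommRing R] [Algebra Qq R] (x : ℚ) (ν : R) (k : ℕ) : R :=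
  coef R (q ^ (k * (k - 1))) * ν ^ k * coef R (qBinom x k)

end Category

/-! ### Quotients by tensor ideals -/

section Ideal

variable (R : Type*) [Semiring R] {C : Type*} [Category C] [Preadditive C] [Linear R C]
  [MonoidalCategory C]

/-- Membership in the two-sided tensor ideal of an `R`-linear monoidal category generated by a
family `S` of morphisms. -/
inductive InTensorIdeal (S : ∀ X Y : C, (X ⟶ Y) → Prop) : ∀ {X Y : C}, (X ⟶ Y) → Prop
  | of {X Y : C} {f : X ⟶ Y} (hf : S X Y f) : InTensorIdeal S f
  | zero (X Y : C) : InTensorIdeal S (0 : X ⟶ Y)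
  | add {X Y : C} {f g : X ⟶ Y} : InTensorIdeal S f → InTensorIdeal S g → InTensorIdeal S (f + g)
  | smul {X Y : C} (r : R) {f : X ⟶ Y} : InTensorIdeal S f → InTensorIdeal S (r • f)
  | comp_left {X Y Z : C} (f : X ⟶ Y) {g : Y ⟶ Z} : InTensorIdeal S g → InTensorIdeal S (f ≫ g)
  | comp_right {X Y Z : C} {f : X ⟶ Y} (g : Y ⟶ Z) : InTensorIdeal S f → InTensorIdeal S (f ≫ g)
  | whiskerLeft (Z : C) {X Y : C} {f : X ⟶ Y} : InTensorIdeal S f → InTensorIdeal S (Z ◁ f)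
  | whiskerRight {X Y : C} {f : X ⟶ Y} (Z : C) : InTensorIdeal S f → InTensorIdeal S (f ▷ Z)

/-- The component at `(X, Y)` of the tensor ideal generated by `S`. -/
def tensorIdeal (S : ∀ X Y : C, (X ⟶ Y) → Prop) (X Y : C) : Submodule R (X ⟶ Y) where
  carrier := {f | InTensorIdeal R S f}
  zero_mem' := .zero X Y
  add_mem' := .add
  smul_mem' r _ := .smul r

end Ideal

/-- The `R`-module `End(∅)` in the quotient of `xWeb` obtained by setting all edges with a label
`k > n` equal to zero. -/
abbrev BoundedEnd {R : Type u} [CommRing R] [Algebra Qq R] (x : ℚ) (ν : R) (n : ℕ) : Type u :=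
  (𝟙_ (XWeb x ν) ⟶ 𝟙_ (XWeb x ν)) ⧸
    tensorIdeal R (Web.LargeEdge n) (𝟙_ (XWeb x ν)) (𝟙_ (XWeb x ν))

/-- The class of the empty web in `BoundedEnd x ν n`. -/
def emptyWeb {R : Type u} [CommRing R] [Algebra Qq R] (x : ℚ) (ν : R) (n : ℕ) :
    BoundedEnd x ν n :=
  Submodule.Quotient.mk (𝟙 (𝟙_ (XWeb x ν)))

end

end QWeb

/-! The circle values in `∞Web` are products of factors `(a q^{-i} - a⁻¹ q^i) / (q - q⁻¹)`, so the
first claim is a computation at `a = q ν δ_x`. As `δ_x ν² = 1`, one has `a⁻¹ = q⁻¹ ν`. The shift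
rule `{y + 1} = 1 + q² {y}` (`qRat_add_one`) says that `1 + (q² - 1){y}`, a substitute for `q^{2y}`,
is multiplied by `q²` when `y` grows by `1`. Hence `δ_x` determines every `{x - i}` (`qDelta_eq`),
and the `i`-th factor becomes `ν q^i {x - i}` (`bracket_parameter`).

For the second claim, `{y}` is regular at `q = 1` with value `y` (`SpecializesTo.qRat`), so `{x -
i}` can vanish only for `x = i`.

For the third, the circle labelled `n + 1` passes through an edge that is killed, and so it is zero
in the quotient. It is also a multiple of the empty web by a scalar, which the first two claims show
to be a unit unless `x` is one of `0, …, n`. The annihilator `r` is thus even invertible. -/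

namespace QWeb

/-! ### Rational functions regular at `q = 1` -/

section Specialization

/-- `f` is regular at `q = 1`, where it takes the value `v`. -/
def SpecializesTo (f : Qq) (v : ℚ) : Prop :=
  ∃ p r : Polynomial ℚ, r.eval 1 ≠ 0 ∧ p.eval 1 = v * r.eval 1 ∧
    f * algebraMap (Polynomial ℚ) Qq r = algebraMap (Polynomial ℚ) Qq p

namespace SpecializesTo

theorem const (c : ℚ) : SpecializesTo (algebraMap ℚ Qq c) c :=
  ⟨Polynomial.C c, 1, by simp, by simp, by
    rw [map_one, mul_one, IsScalarTower.algebraMap_apply ℚ (Polynomial ℚ) Qq]; rfl⟩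

theorem zero : SpecializesTo 0 0 := by simpa using const 0

theorem one : SpecializesTo 1 1 := by simpa using const 1

theorem q_one : SpecializesTo q 1 :=
  ⟨Polynomial.X, 1, by simp, by simp, by simp [q, RatFunc.algebraMap_X]⟩

theorem add {f g : Qq} {v w : ℚ} (hf : SpecializesTo f v) (hg : SpecializesTo g w) :
    SpecializesTo (f + g) (v + w) := by
  obtain ⟨p, r, hr, hp, hf⟩ := hf
  obtain ⟨p', r', hr', hp', hg⟩ := hg
  refine ⟨p * r' + p' * r, r * r', by simp [hr, hr'], ?_, ?_⟩
  · simp only [Polynomial.eval_add, Polynomial.eval_mul, hp, hp']; ring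
  · simp only [map_add, map_mul, ← hf, ← hg]; ring

theorem mul {f g : Qq} {v w : ℚ} (hf : SpecializesTo f v) (hg : SpecializesTo g w) :
    SpecializesTo (f * g) (v * w) := by
  obtain ⟨p, r, hr, hp, hf⟩ := hf
  obtain ⟨p', r', hr', hp', hg⟩ := hg
  refine ⟨p * p', r * r', by simp [hr, hr'], ?_, ?_⟩
  · simp only [Polynomial.eval_mul, hp, hp']; ring
  · simp only [map_mul, ← hf, ← hg]; ring

theorem sub {f g : Qq} {v w : ℚ} (hf : SpecializesTo f v) (hg : SpecializesTo g w) :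
    SpecializesTo (f - g) (v - w) := by
  have h := hf.add ((const (-1)).mul hg)
  rw [map_neg, map_one] at h
  convert h using 1 <;> ring

/-- The purpose of specialization: every non-vanishing of a `q`-rational below is read off from its
value at `q = 1`. -/
theorem ne_zero {f : Qq} {v : ℚ} (hf : SpecializesTo f v) (hv : v ≠ 0) : f ≠ 0 := by
  rintro rfl
  obtain ⟨p, r, hr, hp, hf⟩ := hf
  rw [zero_mul, eq_comm, FaithfulSMul.algebraMap_eq_zero_iff] at hf
  rw [hf, Polynomial.eval_zero] at hp
  exact mul_ne_zero hv hr hp.symm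

theorem inv {f : Qq} {v : ℚ} (hf : SpecializesTo f v) (hv : v ≠ 0) : SpecializesTo f⁻¹ v⁻¹ := by
  have hf0 := hf.ne_zero hv
  obtain ⟨p, r, hr, hp, hf⟩ := hf
  -- Numerator and denominator trade places; `p(1) = v r(1)` is nonzero because `v` is.
  refine ⟨r, p, by rw [hp]; exact mul_ne_zero hv hr, by rw [hp]; field_simp, ?_⟩
  rw [← hf]; field_simp

theorem div {f g : Qq} {v w : ℚ} (hf : SpecializesTo f v) (hg : SpecializesTo g w) (hw : w ≠ 0) :
    SpecializesTo (f / g) (v / w) := by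
  simpa only [div_eq_mul_inv] using hf.mul (hg.inv hw)

theorem q_pow (n : ℕ) : SpecializesTo (q ^ n) 1 := by
  induction n with
  | zero => simpa using one
  | succ n ih => simpa [pow_succ] using ih.mul q_one

theorem q_zpow (n : ℤ) : SpecializesTo (q ^ n) 1 := by
  cases n with
  | ofNat n => simpa using q_pow n
  | negSucc n => simpa [zpow_negSucc] using (q_pow (n + 1)).inv one_ne_zero

end SpecializesTo

end Specialization

/-! ### Quantum integers and `q`-rationals: value at `q = 1` and shift by `1` -/

section QuantumNumbers

theorem q_ne_zero : q ≠ 0 := SpecializesTo.q_one.ne_zero one_ne_zero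

/-- This function vanishes at `q = 1`, so specialization is of no help; `X² - 1` is a nonzero
polynomial. -/
theorem q_sq_sub_one_ne_zero : q ^ 2 - 1 ≠ 0 := by
  have h : (algebraMap (Polynomial ℚ) Qq) (Polynomial.X ^ 2 - Polynomial.C 1) ≠ 0 := by
    rw [Ne, FaithfulSMul.algebraMap_eq_zero_iff]
    exact Polynomial.X_pow_sub_C_ne_zero two_pos 1
  simpa [q, RatFunc.algebraMap_X] using h

theorem qInt_add_one (n : ℤ) : qInt (n + 1) = 1 + q ^ 2 * qInt n := by
  have h := q_sq_sub_one_ne_zero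
  have e : q ^ (2 * (n + 1)) = q ^ (2 * n) * q ^ 2 := by
    rw [mul_add, zpow_add₀ q_ne_zero]; norm_cast
  rw [qInt, qInt, e]
  field_simp
  ring

/-- The defining quotient is `0/0` at `q = 1`. The recursion `{n + 1} = 1 + q² {n}`, run in both
directions from `{0} = 0`, avoids the division by `q² - 1`. -/
theorem SpecializesTo.qInt (n : ℤ) : SpecializesTo (qInt n) n := by
  induction n with
  | zero => simpa [QWeb.qInt] using SpecializesTo.zero
  | succ n ih =>
    rw [qInt_add_one]
    convert one.add ((q_pow 2).mul ih) using 1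
    push_cast; ring
  | pred n ih =>
    have h := qInt_add_one (-(n : ℤ) - 1)
    rw [sub_add_cancel] at h
    have e : QWeb.qInt (-(n : ℤ) - 1) = (QWeb.qInt (-n) - 1) / q ^ 2 := by
      rw [eq_div_iff (pow_ne_zero _ q_ne_zero), h]; ring
    rw [e]
    convert (ih.sub one).div (q_pow 2) one_ne_zero using 1
    push_cast; ring

theorem qIntInv_eq (n : ℤ) : qIntInv n = q ^ 2 * (q ^ (-(2 * n)) * qInt n) := by
  have h := q_sq_sub_one_ne_zero
  have hq := q_ne_zero
  have h' : q ^ (-2 : ℤ) - 1 ≠ 0 := by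
    have e : q ^ (-2 : ℤ) - 1 = -(q ^ 2 - 1) / q ^ 2 := by
      rw [zpow_neg]; norm_cast; field_simp; ring
    rw [e]
    exact div_ne_zero (neg_ne_zero.2 h) (pow_ne_zero _ hq)
  have hn : q ^ (2 * n) ≠ 0 := zpow_ne_zero _ hq
  rw [qIntInv, QWeb.qInt, div_eq_iff h', zpow_neg q (2 * n)]
  field_simp
  ring

theorem SpecializesTo.qIntInv (n : ℤ) : SpecializesTo (qIntInv n) n := by
  rw [qIntInv_eq]
  simpa using (q_pow 2).mul ((q_zpow (-(2 * n))).mul (.qInt n))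

/-- At `q = 1` powers of `q` become `1` and quantum integers become integers, so the deformed
continued fraction turns into the ordinary one. Its denominators are inverses of nonzero fractional
parts (or the final `1` for an integer), which keeps every division legitimate. -/
theorem SpecializesTo.qRat (x : ℚ) : SpecializesTo (qRat x) x := by
  induction x using evenCF.induct with
  | case1 x h =>
    rw [QWeb.qRat, evenCF.eq_def, if_pos h, qCF]
    have hx := Int.floor_add_fract x
    have := (SpecializesTo.qInt (⌊x⌋ - 1)).add
      ((q_zpow (2 * (⌊x⌋ - 1))).div (.qIntInv 1) (by norm_num))
    convert this using 1
    push_cast; linarith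
  | case2 x h h' =>
    rw [QWeb.qRat, evenCF.eq_def, if_neg h, dif_pos h', qCF]
    have hx := Int.floor_add_fract x
    have hb := Int.floor_add_fract (Int.fract x)⁻¹
    rw [h', add_zero] at hb
    have := (SpecializesTo.qInt ⌊x⌋).add
      ((q_zpow (2 * ⌊x⌋)).div (.qIntInv ⌊(Int.fract x)⁻¹⌋) (by rw [hb]; exact inv_ne_zero h))
    convert this using 1
    rw [hb, one_div, inv_inv, hx]
  | case3 x h h' ih =>
    rw [QWeb.qRat, evenCF.eq_def, if_neg h, dif_neg h', qCF]
    have hx := Int.floor_add_fract x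
    have hb := Int.floor_add_fract (Int.fract x)⁻¹
    have hy := (SpecializesTo.qIntInv ⌊(Int.fract x)⁻¹⌋).add
      ((q_zpow (-(2 * ⌊(Int.fract x)⁻¹⌋))).div ih (inv_ne_zero h'))
    -- With `y = (Int.fract x)⁻¹`, the denominator under `⌊x⌋` takes the value `⌊y⌋ + Int.fract y =
    -- y`.
    rw [one_div, inv_inv, hb] at hy
    have := (SpecializesTo.qInt ⌊x⌋).add ((q_zpow (2 * ⌊x⌋)).div hy (inv_ne_zero h))
    rwa [one_div, inv_inv, hx] at this

/-- The first entry occurs only in `{a}` and in the factor `q^{2a}` of the first numerator; the tail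
of the fraction is untouched. -/
theorem qCF_add_one (a b : ℤ) (l : List (ℤ × ℤ)) :
    qCF (a + 1, b) l = 1 + q ^ 2 * qCF (a, b) l := by
  have e : q ^ (2 * (a + 1)) = q ^ 2 * q ^ (2 * a) := by
    rw [mul_add, add_comm, zpow_add₀ q_ne_zero]; norm_cast
  cases l <;> simp only [qCF, qInt_add_one, e] <;> ring

theorem evenCF_add_one (x : ℚ) :
    evenCF (x + 1) = (((evenCF x).1.1 + 1, (evenCF x).1.2), (evenCF x).2) := by
  rw [evenCF.eq_def, evenCF.eq_def x]
  simp only [Int.fract_add_one, Int.floor_add_one]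
  split_ifs <;> simp

theorem qRat_add_one (x : ℚ) : qRat (x + 1) = 1 + q ^ 2 * qRat x := by
  rw [qRat, evenCF_add_one, qCF_add_one, qRat]

/-- The value of `δ_x` at `q = 1` is `x - (x - 1) = 1`. -/
theorem qDelta_ne_zero (x : ℚ) : qDelta x ≠ 0 := by
  refine ((SpecializesTo.qRat x).sub (.qRat (x - 1))).ne_zero ?_
  norm_num

theorem qFactorial_ne_zero (k : ℕ) : qFactorial k ≠ 0 := by
  refine Finset.prod_ne_zero_iff.2 fun i _ => (SpecializesTo.qInt _).ne_zero ?_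
  norm_cast

theorem qBinom_ne_zero {x : ℚ} {k : ℕ} (h : ¬ ∃ m : ℕ, x = m ∧ m < k) : qBinom x k ≠ 0 := by
  refine div_ne_zero (Finset.prod_ne_zero_iff.2 fun i hi => ?_) (qFactorial_ne_zero k)
  exact (SpecializesTo.qRat _).ne_zero fun h0 =>
    h ⟨i, sub_eq_zero.1 h0, Finset.mem_range.1 hi⟩

/-- All `q`-rationals in `x + ℤ` are determined by `δ_x`. -/
theorem qDelta_eq (x : ℚ) (i : ℕ) :
    q ^ 2 * qDelta x = q ^ (2 * i) * (1 + (q ^ 2 - 1) * qRat (x - i)) := by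
  induction i with
  | zero =>
    have h := qRat_add_one (x - 1)
    rw [sub_add_cancel] at h
    simp only [qDelta, Nat.cast_zero, sub_zero]
    -- Substituting `q² {x - 1} = {x} - 1` gives `q² δ_x = 1 + (q² - 1){x}`.
    linear_combination h
  | succ i ih =>
    have h := qRat_add_one (x - (i + 1 : ℕ))
    rw [show x - (i + 1 : ℕ) + 1 = x - i by push_cast; ring] at h
    rw [ih, h]
    ring

end QuantumNumbers

/-! ### Circle values at the parameter `a = q ν δ_x` -/

section Circles

variable {R : Type u} [CommRing R] [Algebra Qq R] {x : ℚ} {ν : R}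

theorem coef_qDelta_mul_sq (hν : ν ^ 2 = algebraMap Qq R (qDelta x)⁻¹) :
    coef R (qDelta x) * ν ^ 2 = 1 := by
  rw [hν, ← map_mul, mul_inv_cancel₀ (qDelta_ne_zero x), map_one]

theorem inverse_parameter (hν : ν ^ 2 = algebraMap Qq R (qDelta x)⁻¹) :
    Ring.inverse (coef R q * ν * coef R (qDelta x)) = coef R q⁻¹ * ν := by
  have hq : coef R q * coef R q⁻¹ = 1 := by
    rw [← map_mul, mul_inv_cancel₀ q_ne_zero, map_one]
  have h : coef R q * ν * coef R (qDelta x) * (coef R q⁻¹ * ν) = 1 := by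
    linear_combination coef R q * coef R q⁻¹ * coef_qDelta_mul_sq hν + hq
  have hu := IsUnit.of_mul_eq_one _ h
  -- `Ring.inverse` is a true inverse only on units, so the explicit inverse serves first to show
  -- that `a` is a unit.
  exact hu.mul_left_cancel (by rw [Ring.mul_inverse_cancel _ hu, h])

/-- After substituting `a` and `a⁻¹`, a factor `ν` comes out and `q^{1-i} δ_x - q^{i-1}` is left
over `q - q⁻¹`; `qDelta_eq` evaluates this quotient. -/
theorem bracket_parameter (hν : ν ^ 2 = algebraMap Qq R (qDelta x)⁻¹) (i : ℕ) :
    bracket (coef R q * ν * coef R (qDelta x)) i = ν * coef R (q ^ i * qRat (x - i)) := by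
  have hq := q_ne_zero
  have key : (q - q⁻¹)⁻¹ * (q * qDelta x * q ^ (-(i : ℤ)) - q⁻¹ * q ^ i) =
      q ^ i * qRat (x - i) := by
    have h := qDelta_eq x i
    have h2 := q_sq_sub_one_ne_zero
    have e : q - q⁻¹ = (q ^ 2 - 1) / q := by field_simp
    rw [e, zpow_neg, zpow_natCast]
    field_simp
    rw [pow_mul'] at h
    linear_combination h
  rw [bracket, inverse_parameter hν, ← key]
  simp only [coef, map_mul, map_sub]
  ring

theorem circleValue_parameter (hν : ν ^ 2 = algebraMap Qq R (qDelta x)⁻¹) (k : ℕ) :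
    circleValue (coef R q * ν * coef R (qDelta x)) k = xCircleValue x ν k := by
  -- One half of the exponent is the factor built into `circleValue`, the other is `∑ i` over `i <
  -- k`, from the powers `q^i` in the brackets.
  have e : q ^ (k * (k - 1)) = q ^ (k * (k - 1) / 2) * q ^ (k * (k - 1) / 2) := by
    rw [← pow_add, ← two_mul, Nat.mul_div_cancel' (Nat.even_mul_pred_self k).two_dvd]
  simp only [circleValue, xCircleValue, qBinom, bracket_parameter hν, Finset.prod_mul_distrib,
    Finset.prod_const, Finset.card_range, e, ← map_prod]
  rw [Finset.prod_pow_eq_pow_sum, Finset.sum_range_id]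
  simp only [coef, map_mul, div_eq_mul_inv]
  ring

theorem isUnit_xCircleValue (hν : ν ^ 2 = algebraMap Qq R (qDelta x)⁻¹) {k : ℕ}
    (h : ¬ ∃ m : ℕ, x = m ∧ m < k) : IsUnit (xCircleValue x ν k) := by
  have hu : IsUnit ν := by
    -- `δ_x ν` is the inverse of `ν`, because `δ_x ν² = 1`.
    refine IsUnit.of_mul_eq_one (coef R (qDelta x) * ν) ?_
    linear_combination coef_qDelta_mul_sq hν
  exact (((pow_ne_zero _ q_ne_zero).isUnit.map _).mul (hu.pow k)).mul
    ((qBinom_ne_zero h).isUnit.map _)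

end Circles

/-! ### Circles in the web category and in the tensor ideal -/

namespace Web

variable {R : Type u} [CommRing R] [Algebra Qq R] {a : R}

theorem circleUD_eq (k : ℕ+) :
    (circleUD k : 𝟙_ (Web R a) ⟶ 𝟙_ (Web R a)) = circleValue a k • 𝟙 (𝟙_ (Web R a)) :=
  mk_eq (.circle k)

theorem circleDU_eq (k : ℕ+) :
    (circleDU k : 𝟙_ (Web R a) ⟶ 𝟙_ (Web R a)) = circleValue a k • 𝟙 (𝟙_ (Web R a)) :=
  mk_eq (.circle' k)

/-- A circle factors through its upward strand. -/
theorem circleUD_mem_tensorIdeal {n : ℕ} {k : ℕ+} (hk : n < k) :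
    (circleUD k : 𝟙_ (Web R a) ⟶ 𝟙_ (Web R a)) ∈ tensorIdeal R (LargeEdge n) _ _ := by
  have h : InTensorIdeal R (LargeEdge n)
      ((mk (.cupUD k) : 𝟙_ (Web R a) ⟶ up k ⊗ down k) ≫ (𝟙 (up k) ▷ down k) ≫
        (mk (.capUD k) : up k ⊗ down k ⟶ 𝟙_ (Web R a))) :=
    .comp_left _ (.comp_right _ (.whiskerRight _ (.of (.mk k hk))))
  -- The whiskered identity of the killed edge is itself an identity, so the composite is just the
  -- cap after the cup.
  rw [id_whiskerRight, Category.id_comp] at h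
  exact h

end Web

end QWeb

theorem mainTheorem5 {R : Type u} [CommRing R] [Nontrivial R] [Algebra QWeb.Qq R] (x : ℚ)
    (ν : R) (hν : ν ^ 2 = algebraMap QWeb.Qq R (QWeb.qDelta x)⁻¹) :
    (∀ k : ℕ+,
      (QWeb.Web.circleUD k : 𝟙_ (QWeb.XWeb x ν) ⟶ 𝟙_ (QWeb.XWeb x ν)) =
          QWeb.xCircleValue x ν k • 𝟙 (𝟙_ (QWeb.XWeb x ν)) ∧
      (QWeb.Web.circleDU k : 𝟙_ (QWeb.XWeb x ν) ⟶ 𝟙_ (QWeb.XWeb x ν)) =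
          QWeb.xCircleValue x ν k • 𝟙 (𝟙_ (QWeb.XWeb x ν))) ∧
    (∀ k : ℕ, ¬ (∃ m : ℕ, x = m ∧ m < k) → QWeb.qBinom x k ≠ 0) ∧
    ∀ n : ℕ, ¬ (∃ m : ℕ, x = m ∧ m ≤ n) →
      QWeb.emptyWeb x ν n ∈ Submodule.torsion R (QWeb.BoundedEnd x ν n) := by
  refine ⟨fun k => ?_, fun k => QWeb.qBinom_ne_zero, fun n hn => ?_⟩
  · rw [← QWeb.circleValue_parameter hν]
    exact ⟨QWeb.Web.circleUD_eq k, QWeb.Web.circleDU_eq k⟩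
  -- The smallest killed label `n + 1` suffices: its binomial involves `{x}, …, {x - n}`, none of
  -- which vanishes under `hn`.
  · have hr : IsUnit (QWeb.xCircleValue x ν (n + 1)) :=
      QWeb.isUnit_xCircleValue hν (by simpa only [Nat.lt_succ_iff] using hn)
    refine ⟨⟨_, hr.mem_nonZeroDivisors⟩, ?_⟩
    have h := QWeb.Web.circleUD_mem_tensorIdeal (a := QWeb.coef R QWeb.q * ν *
      QWeb.coef R (QWeb.qDelta x)) (k := n.succPNat) n.lt_succ_self
    rw [QWeb.Web.circleUD_eq, QWeb.circleValue_parameter hν] at h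
    -- The scalar multiple of the class of the empty web is the class of the circle, which lies in
    -- the ideal.
    exact (Submodule.Quotient.mk_eq_zero _).2 h
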